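/- Let $k$ be a field of prime characteristic $p$, let $n\ge 2$, and set $$R=\frac{k[t,x_1,\ldots,x_n]}{(f_1,\ldots,f_r)},$$ where $t,x_1,\ldots,x_n$ are variables and $f_1,\ldots,f_r$ are homogeneous polynomials with respect to the grading in which $\deg t=0$ and $\deg x_i=1$ for $i=1,\ldots,n$. Let $I=(x_1,\ldots,x_n)\subseteq R$. For an ideal $J$ of $R$ and a power $q$ of $p$, let $J^{[q]}$ denote the ideal generated by the $q$-th powers of the elements of $J$ (equivalently, of a set of generators of $J$), and for a non-negative integer $c$ write $J^{c[q]}=(J^{c})^{[q]}$. Then there is a constant $c$ such that for every $q=p^e$, $e\ge 0$, there is a primary decomposition $$I^{[q]}=Q_1\cap Q_2\cap\cdots\cap Q_m$$ (with $m$ depending on $q$) such that $(\sqrt{Q_i})^{c[q^{n-1}]}\subseteq Q_i$ for all $i=1,\ldots,m$. (If $R=0$, the empty decomposition $m=0$ of the unit ideal is allowed.) -/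

import Mathlib

open MvPolynomial

/-- The `q`-th Frobenius (bracket) power `J^[q]` of an ideal `J`: the ideal generated by the `q`-th
powers of the elements of `J`. In characteristic `p` and for `q` a power of `p` it is generated by
the `q`-th powers of any set of generators of `J`, see `Ideal.frobeniusPower_span`. -/
def Ideal.frobeniusPower {R : Type*} [CommRing R] (J : Ideal R) (q : ℕ) : Ideal R :=
  Ideal.span ((fun a => a ^ q) '' (J : Set R))

theorem Ideal.frobeniusPower_span {R : Type*} [CommRing R] {p : ℕ} (hp : p.Prime)
    (hR : (p : R) = 0) (e : ℕ) (S : Set R) :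
    (Ideal.span S).frobeniusPower (p ^ e) = Ideal.span ((fun a => a ^ p ^ e) '' S) := by
  apply le_antisymm
  · refine Ideal.span_le.mpr ?_
    rintro _ ⟨a, ha, rfl⟩
    change a ^ p ^ e ∈ Ideal.span ((fun a => a ^ p ^ e) '' S)
    refine Submodule.span_induction (p := fun x _ => x ^ p ^ e ∈ _) ?_ ?_ ?_ ?_ ha
    · exact fun x hx => Ideal.subset_span ⟨x, hx, rfl⟩
    · rw [zero_pow (pow_ne_zero e hp.ne_zero)]
      exact Ideal.zero_mem _
    · intro x y _ _ hx hy
      obtain ⟨r, hr⟩ := exists_add_pow_prime_pow_eq hp x y e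
      rw [hr, hR]
      simpa using Ideal.add_mem _ hx hy
    · intro a x _ hx
      rw [smul_eq_mul, mul_pow]
      exact Ideal.mul_mem_left _ _ hx
  · exact Ideal.span_mono (Set.image_mono Ideal.subset_span)

/-- The grading on `k[t, x_1, …, x_n]` with `deg t = 0` and `deg x_i = 1`. The variable `t` is
`X none` and the variable `x_i` is `X (some i)`. -/
def txWeight (n : ℕ) : Option (Fin n) → ℕ
  | none => 0
  | some _ => 1

/-- The ring `R = k[t, x_1, …, x_n] / (f_1, …, f_r)`. -/
abbrev TXQuotient {k : Type*} [Field k] {n r : ℕ}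
    (f : Fin r → MvPolynomial (Option (Fin n)) k) : Type _ :=
  MvPolynomial (Option (Fin n)) k ⧸ Ideal.span (Set.range f)

/-- The ideal `(x_1, …, x_n)` of `R = k[t, x_1, …, x_n] / (f_1, …, f_r)`. -/
noncomputable def xIdeal {k : Type*} [Field k] {n r : ℕ}
    (f : Fin r → MvPolynomial (Option (Fin n)) k) : Ideal (TXQuotient f) :=
  Ideal.span (Set.range fun i : Fin n =>
    Ideal.Quotient.mk (Ideal.span (Set.range f)) (X (some i)))

/-! View `R` as a quotient of `k[t][x]`, with `J = I^[q]` generated by homogeneous forms in `x` and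
the `x_i^q`. In each `x`-degree, `R/J` is the cokernel of a `k[t]`-matrix. It has at most `q^(n-1)`
rows, and entries of `t`-degree at most a constant `D`. A maximal-rank minor kills the torsion, so
the torsion of each piece has exponent at most `D * q^(n-1)` at every irreducible `g`
(`Polynomial.exists_smul_mem_span_of_natDegree_le`). Hence so does the generator `h` of the
annihilator of all torsion (`exists_torsion_annihilator_powerIdeal`).

Then `J = (J : h) ∩ (J + (h))`. The first ideal is primary with radical `I`, or the unit ideal. A
primary component of the second has radical inside `I + (g)` for some irreducible `g` and contains
`g^e`, where `e` is the multiplicity of `g` in `h`; the bound on `e` gives the inclusion of bracket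
powers (`exists_primary_decomposition_of_torsion_annihilator`). -/

/-! ### Torsion in cokernels of polynomial matrices -/

theorem Matrix.natDegree_det_le {k ι : Type*} [CommRing k] [Fintype ι] [DecidableEq ι]
    (M : Matrix ι ι (Polynomial k)) (D : ℕ) (hM : ∀ i j, (M i j).natDegree ≤ D) :
    M.det.natDegree ≤ D * Fintype.card ι := by
  rw [Matrix.det_apply]
  refine Polynomial.natDegree_sum_le_of_forall_le _ _ fun σ _ => ?_
  refine (Polynomial.natDegree_smul_le _ _).trans ((Polynomial.natDegree_prod_le _ _).trans ?_)
  refine (Finset.sum_le_card_nsmul _ _ D fun i _ => hM _ _).trans ?_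
  simp [mul_comm]

/-- The torsion of the cokernel of a polynomial matrix with `card ι` rows and entries of degree at
most `D` is annihilated by a nonzero polynomial of degree at most `D * card ι`. -/
theorem Polynomial.exists_smul_mem_span_of_natDegree_le {k ι G : Type*} [Field k] [Fintype ι]
    (w : G → ι → Polynomial k) (D : ℕ) (hw : ∀ g i, (w g i).natDegree ≤ D) :
    ∃ h : Polynomial k, h ≠ 0 ∧ h.natDegree ≤ D * Fintype.card ι ∧
      ∀ s : Polynomial k, s ≠ 0 → ∀ z : ι → Polynomial k,
        s • z ∈ Submodule.span (Polynomial k) (Set.range w) →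
        h • z ∈ Submodule.span (Polynomial k) (Set.range w) := by
  classical
  let K := FractionRing (Polynomial k)
  let φ : Polynomial k →+* K := algebraMap _ _
  have hφ : Function.Injective φ := IsFractionRing.injective _ _
  -- Complete a maximal independent set of columns to a basis by unit vectors; these have degree 0,
  -- so the determinant bound is unaffected.
  let u : G ⊕ ι → ι → Polynomial k := Sum.elim w (fun i => Pi.single i 1)
  let v : G ⊕ ι → ι → K := fun x i => φ (u x i)
  have hu : ∀ x i, (u x i).natDegree ≤ D := by
    rintro (g | j) i
    · exact hw g i
    · by_cases hij : i = j
      · subst hij; simp [u]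
      · simp [u, Pi.single_eq_of_ne hij]
  obtain ⟨b₁, hb₁, -, hspan₁, hli₁⟩ := exists_linearIndepOn_extension (K := K) (v := v)
    (linearIndepOn_empty K v) (Set.empty_subset (Set.range Sum.inl))
  obtain ⟨b, -, hb₁b, hspan, hli⟩ := exists_linearIndepOn_extension (K := K) (v := v)
    hli₁ (Set.subset_univ b₁)
  have htop : ⊤ ≤ Submodule.span K (Set.range fun x : b => v x) := by
    rw [← (Pi.basisFun K ι).span_eq, Submodule.span_le]
    rintro _ ⟨i, rfl⟩
    have h1 : v (Sum.inr i) ∈ Submodule.span K (v '' b) := hspan ⟨_, trivial, rfl⟩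
    rw [Set.image_eq_range] at h1
    have h2 : v (Sum.inr i) = Pi.basisFun K ι i := by
      ext j
      by_cases hij : j = i
      · subst hij; simp [v, u]
      · simp [v, u, Pi.single_eq_of_ne hij]
    rw [← h2]
    exact h1
  let B := Module.Basis.mk (v := fun x : b => v x) hli htop
  let eb : ι ≃ b := (Pi.basisFun K ι).indexEquiv B
  let M : Matrix ι ι (Polynomial k) := Matrix.of fun i j => u (eb j) i
  have hcol : LinearIndependent K (M.map φ).col := by
    have : (M.map φ).col = (fun x : b => v x) ∘ eb := by
      ext j i; simp [M, v]
    rw [this]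
    exact hli.comp _ eb.injective
  have hdet : M.det ≠ 0 := by
    intro h0
    have h1 : (M.map φ).det = 0 := by
      rw [← RingHom.mapMatrix_apply, ← RingHom.map_det, h0, map_zero]
    have := (Matrix.isUnit_iff_isUnit_det _).mp (Matrix.linearIndependent_cols_iff_isUnit.mp hcol)
    rw [h1] at this
    exact not_isUnit_zero this
  refine ⟨M.det, hdet, Matrix.natDegree_det_le M D fun i j => hu _ _, fun s hs z hz => ?_⟩
  -- `z` is a combination over `K` of the vectors in `b₁`
  have hzK : (fun i => φ (z i)) ∈ Submodule.span K (v '' b₁) := by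
    have h1 : ∀ y ∈ Submodule.span (Polynomial k) (Set.range w),
        (fun i => φ (y i)) ∈ Submodule.span K (v '' b₁) := by
      intro y hy
      induction hy using Submodule.span_induction with
      | mem x hx =>
        obtain ⟨g, rfl⟩ := hx
        exact hspan₁ ⟨Sum.inl g, ⟨g, rfl⟩, rfl⟩
      | zero =>
        have h0 : (fun i => φ ((0 : ι → Polynomial k) i)) = 0 := by ext; simp
        rw [h0]
        exact Submodule.zero_mem _
      | add x y _ _ hx hy => simpa using! Submodule.add_mem _ hx hy
      | smul a x _ hx => simpa using! Submodule.smul_mem _ (φ a) hx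
    have h2 := Submodule.smul_mem _ (φ s)⁻¹ (h1 _ hz)
    convert h2 using 1
    ext i
    have : φ s ≠ 0 := by simpa using hφ.ne hs
    simp [inv_mul_cancel_left₀ this]
  have hcoef : ∃ c : ι → K, (∀ j, (eb j : G ⊕ ι) ∉ b₁ → c j = 0) ∧
      (M.map φ).mulVec c = fun i => φ (z i) := by
    have h1 : ∀ y ∈ Submodule.span K (v '' b₁), ∃ c : ι → K,
        (∀ j, (eb j : G ⊕ ι) ∉ b₁ → c j = 0) ∧ (M.map φ).mulVec c = y := by
      intro y hy
      induction hy using Submodule.span_induction with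
      | mem x hx =>
        obtain ⟨x, hx, rfl⟩ := hx
        refine ⟨Pi.single (eb.symm ⟨x, hb₁b hx⟩) 1, fun j hj => ?_, ?_⟩
        · refine Pi.single_eq_of_ne ?_ _
          rintro rfl
          simp [hx] at hj
        · ext i
          simp [M, v]
      | zero => exact ⟨0, by simp, by simp⟩
      | add x y _ _ hx hy =>
        obtain ⟨c, hc, rfl⟩ := hx
        obtain ⟨c', hc', rfl⟩ := hy
        exact ⟨c + c', fun j hj => by simp [hc j hj, hc' j hj], Matrix.mulVec_add _ _ _⟩
      | smul a x _ hx =>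
        obtain ⟨c, hc, rfl⟩ := hx
        exact ⟨a • c, fun j hj => by simp [hc j hj], Matrix.mulVec_smul _ _ _⟩
    exact h1 _ hzK
  obtain ⟨c, hc0, hc⟩ := hcoef
  -- By Cramer's rule `det M * c` has polynomial entries, and it vanishes at the added unit vectors
  -- because `c` does.
  let y := M.adjugate.mulVec z
  have hy : ∀ j, φ (y j) = φ M.det * c j := by
    have h1 : (fun j => φ (y j)) = (M.map φ).adjugate.mulVec (fun i => φ (z i)) := by
      ext j
      rw [← RingHom.mapMatrix_apply, ← RingHom.map_adjugate]
      exact RingHom.map_mulVec φ _ _ _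
    intro j
    have h2 := congrFun h1 j
    rw [← hc, Matrix.mulVec_mulVec, Matrix.adjugate_mul, ← RingHom.mapMatrix_apply,
      ← RingHom.map_det, Matrix.smul_mulVec, Matrix.one_mulVec] at h2
    exact h2
  have hyz : M.det • z = ∑ j, y j • u (eb j) := by
    have h1 : M.det • z = M.mulVec y := by
      rw [Matrix.mulVec_mulVec, Matrix.mul_adjugate, Matrix.smul_mulVec, Matrix.one_mulVec]
    rw [h1]
    ext i
    simp [Matrix.mulVec, dotProduct, M, mul_comm]
  rw [hyz]
  refine Submodule.sum_mem _ fun j _ => ?_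
  by_cases hj : (eb j : G ⊕ ι) ∈ b₁
  · obtain ⟨g, hg⟩ := hb₁ hj
    rw [← hg]
    exact Submodule.smul_mem _ _ (Submodule.subset_span ⟨g, rfl⟩)
  · have : y j = 0 := hφ (by rw [hy, hc0 j hj, mul_zero, map_zero])
    rw [this, zero_smul]
    exact Submodule.zero_mem _

/-! ### From a torsion annihilator to a primary decomposition -/

theorem Ideal.pow_mem_frobeniusPower {R : Type*} [CommRing R] {J : Ideal R} {a : R} (ha : a ∈ J)
    (q : ℕ) : a ^ q ∈ J.frobeniusPower q :=
  Ideal.subset_span ⟨a, ha, rfl⟩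

theorem Ideal.sup_pow_le {R : Type*} [CommRing R] {I J : Ideal R} (c : ℕ) :
    (I ⊔ J) ^ c ≤ I ⊔ J ^ c := by
  induction c with
  | zero => simp
  | succ c ih =>
    rw [pow_succ, pow_succ]
    refine (Ideal.mul_mono_left ih).trans ?_
    rw [Ideal.sup_mul, Ideal.mul_sup (I := J ^ c)]
    exact sup_le (le_sup_of_le_left Ideal.mul_le_left)
      (sup_le (le_sup_of_le_left Ideal.mul_le_right) le_sup_right)

theorem add_pow_prime_pow_of_cast_eq_zero {R : Type*} [CommRing R] {p : ℕ} (hp : p.Prime)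
    (hR : (p : R) = 0) (e : ℕ) (x y : R) : (x + y) ^ p ^ e = x ^ p ^ e + y ^ p ^ e := by
  obtain ⟨r, hr⟩ := exists_add_pow_prime_pow_eq hp x y e
  rw [hr, hR]
  ring

/-- Let `B` be a Noetherian ring of characteristic `p` over a principal ideal domain `A`, `I` an
ideal such that `A → B / I` is onto and `J` an ideal containing the `p ^ E`-th powers of elements of
`I`. If the `A`-torsion of `B / J` is annihilated by `h ≠ 0`, and no irreducible element occurs in
`h` with multiplicity larger than `c * p ^ E`, then `J` has a primary decomposition whose components
`Q` satisfy `(√Q ^ c)^[p ^ E] ≤ Q`. -/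
theorem exists_primary_decomposition_of_torsion_annihilator {A B : Type*} [CommRing A] [IsDomain A]
    [IsPrincipalIdealRing A] [CommRing B] [IsNoetherianRing B] {p : ℕ} (hp : p.Prime)
    (hB : (p : B) = 0) (φ : A →+* B) (I J : Ideal B) (hI : ∀ b : B, ∃ a : A, b - φ a ∈ I)
    (E c : ℕ) (hc : 0 < c) (hIJ : ∀ i ∈ I, i ^ p ^ E ∈ J) (h : A) (h0 : h ≠ 0)
    (hh : ∀ b : B, ∀ s : A, s ≠ 0 → φ s * b ∈ J → φ h * b ∈ J)
    (hmul : ∀ g : A, Irreducible g → ∀ e : ℕ, g ^ e ∣ h → e ≤ c * p ^ E) :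
    ∃ (m : ℕ) (Q : Fin m → Ideal B), J = ⨅ i : Fin m, Q i ∧ (∀ i, (Q i).IsPrimary) ∧
      ∀ i, ((Q i).radical ^ c).frobeniusPower (p ^ E) ≤ Q i := by
  classical
  suffices H : ∃ T : Finset (Ideal B), J = T.inf id ∧ ∀ Q ∈ T, Q.IsPrimary ∧
      (Q.radical ^ c).frobeniusPower (p ^ E) ≤ Q by
    obtain ⟨T, hT, hQ⟩ := H
    refine ⟨T.card, fun i => T.equivFin.symm i, ?_, fun i => (hQ _ (T.equivFin.symm i).2).1,
      fun i => (hQ _ (T.equivFin.symm i).2).2⟩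
    rw [hT, T.equivFin.symm.iInf_comp (g := fun x : T => (x : Ideal B)), Finset.inf_eq_iInf,
      iInf_subtype]
    rfl
  -- The colon ideal `J : h`, which is the preimage of the torsion of `B / J`.
  let Q₀ : Ideal B :=
    { carrier := {b | φ h * b ∈ J}
      add_mem' := fun {a b} ha hb => by
        simpa [mul_add] using J.add_mem ha hb
      zero_mem' := by simp
      smul_mem' := fun a b hb => by
        have := J.mul_mem_left a hb
        simpa [mul_left_comm] using this }
  have hQ₀ : ∀ b, b ∈ Q₀ ↔ φ h * b ∈ J := fun b => Iff.rfl
  have hJQ₀ : J ≤ Q₀ := fun b hb => J.mul_mem_left _ hb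
  have hcancel : ∀ (s : A) (b : B), s ≠ 0 → φ s * b ∈ Q₀ → b ∈ Q₀ := by
    intro s b hs hb
    refine hh b (h * s) (mul_ne_zero h0 hs) ?_
    rw [map_mul, mul_assoc]
    exact hb
  have hadd := add_pow_prime_pow_of_cast_eq_zero hp hB E
  -- Modulo `J`, the Frobenius power of `b` equals that of a nonzero scalar, which can be cancelled.
  have hQ₀_mem : ∀ b x : B, b ∉ I → b ^ p ^ E * x ∈ Q₀ → x ∈ Q₀ := by
    intro b x hb hx
    obtain ⟨s, hs⟩ := hI b
    have hs0 : s ≠ 0 := by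
      rintro rfl
      simp at hs
      exact hb hs
    refine hcancel (s ^ p ^ E) x (pow_ne_zero _ hs0) ?_
    have h1 : b ^ p ^ E = (b - φ s) ^ p ^ E + φ s ^ p ^ E := by rw [← hadd, sub_add_cancel]
    have h2 : φ (s ^ p ^ E) * x = b ^ p ^ E * x - (b - φ s) ^ p ^ E * x := by
      rw [h1, map_pow]; ring
    rw [h2]
    exact Q₀.sub_mem hx (Q₀.mul_mem_right _ (hJQ₀ (hIJ _ hs)))
  have hinf : J = Q₀ ⊓ (J ⊔ Ideal.span {φ h}) := by
    refine le_antisymm (le_inf hJQ₀ le_sup_left) ?_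
    rintro z ⟨hz, hz'⟩
    obtain ⟨j, hj, y, hy, rfl⟩ := Submodule.mem_sup.mp hz'
    obtain ⟨w, rfl⟩ := Ideal.mem_span_singleton.mp hy
    refine J.add_mem hj ?_
    refine hcancel h w h0 ?_
    have := Q₀.sub_mem hz (hJQ₀ hj)
    simpa using this
  have hprim₀ : Q₀ ≠ ⊤ → Q₀.IsPrimary ∧ (Q₀.radical ^ c).frobeniusPower (p ^ E) ≤ Q₀ := by
    intro htop
    constructor
    · refine Ideal.isPrimary_iff.mpr ⟨htop, fun {x y} hxy => ?_⟩
      by_cases hy : y ∈ I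
      · exact Or.inr ⟨_, hJQ₀ (hIJ y hy)⟩
      · left
        refine hQ₀_mem y x hy ?_
        obtain ⟨l, hl⟩ := Nat.exists_eq_succ_of_ne_zero (pow_ne_zero E hp.ne_zero)
        rw [hl, pow_succ, mul_assoc, mul_comm y x]
        exact Q₀.mul_mem_left _ hxy
    · have hrad : Q₀.radical ≤ I := by
        rintro b ⟨l, hl⟩
        by_contra hb
        have h1 : ∀ m : ℕ, (b ^ p ^ E) ^ m ∉ Q₀ := by
          intro m
          induction m with
          | zero => simpa [Ideal.ne_top_iff_one] using htop
          | succ m ih =>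
            intro h2
            rw [pow_succ'] at h2
            exact ih (hQ₀_mem b _ hb h2)
        apply h1 l
        rw [← pow_mul, mul_comm, pow_mul]
        exact Ideal.pow_mem_of_mem _ hl _ (pow_pos hp.pos _)
      refine Ideal.span_le.mpr ?_
      rintro _ ⟨a, ha, rfl⟩
      exact hJQ₀ (hIJ a (hrad (Ideal.pow_le_self hc.ne' ha)))
  have hlask : ∀ Q : Ideal B, Q.IsPrimary → J ⊔ Ideal.span {φ h} ≤ Q →
      (Q.radical ^ c).frobeniusPower (p ^ E) ≤ Q := by
    intro Q hQ hle
    have hP := Ideal.isPrime_radical hQ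
    have hJQ : J ≤ Q := le_sup_left.trans hle
    have hhQ : φ h ∈ Q := hle (Ideal.mem_sup_right (Ideal.mem_span_singleton_self _))
    have hIP : I ≤ Q.radical := fun i hi => ⟨_, hJQ (hIJ i hi)⟩
    let 𝔭 : Ideal A := Q.radical.comap φ
    have h𝔭 : 𝔭.IsPrime := Ideal.comap_isPrime φ _
    have hh𝔭 : h ∈ 𝔭 := Ideal.le_radical hhQ
    obtain ⟨g, hg⟩ := IsPrincipalIdealRing.principal 𝔭
    have hg' : 𝔭 = Ideal.span {g} := hg
    have hg0 : g ≠ 0 := by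
      rintro rfl
      rw [hg'] at hh𝔭
      simp at hh𝔭
      exact h0 hh𝔭
    have hgp : Prime g := by
      rw [← Ideal.span_singleton_prime hg0, ← hg']
      exact h𝔭
    -- The part of `h` prime to `g` lies outside the radical of `Q`, so primariness leaves the power
    -- of `g` in `Q`.
    obtain ⟨u, hu, hgu⟩ :=
      (FiniteMultiplicity.of_prime_left hgp h0).exists_eq_pow_mul_and_not_dvd
    generalize multiplicity g h = e at hu
    have hgQ : φ g ^ e ∈ Q := by
      have h1 : φ g ^ e * φ u ∈ Q := by
        rw [← map_pow, ← map_mul, ← hu]; exact hhQ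
      refine ((Ideal.isPrimary_iff.mp hQ).2 h1).resolve_right fun h2 => hgu ?_
      rw [← Ideal.mem_span_singleton, ← hg']
      exact h2
    have hec : e ≤ c * p ^ E := hmul g hgp.irreducible e ⟨u, hu⟩
    have hPle : Q.radical ≤ I ⊔ Ideal.span {φ g} := by
      intro b hb
      obtain ⟨a, ha⟩ := hI b
      have h1 : a ∈ 𝔭 := by
        have := Q.radical.sub_mem hb (hIP ha)
        simpa [𝔭] using this
      rw [hg', Ideal.mem_span_singleton] at h1
      obtain ⟨a', rfl⟩ := h1
      rw [← sub_add_cancel b (φ (g * a')), map_mul]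
      exact Submodule.add_mem_sup (by simpa using ha)
        (Ideal.mem_span_singleton.mpr (dvd_mul_right _ _))
    have hPc : Q.radical ^ c ≤ I ⊔ Ideal.span {φ g ^ c} := by
      refine (Ideal.pow_right_mono hPle c).trans ?_
      rw [← Ideal.span_singleton_pow]
      exact Ideal.sup_pow_le c
    refine Ideal.span_le.mpr ?_
    rintro _ ⟨a, ha, rfl⟩
    obtain ⟨i, hi, y, hy, rfl⟩ := Submodule.mem_sup.mp (hPc ha)
    obtain ⟨w, rfl⟩ := Ideal.mem_span_singleton.mp hy
    change (i + φ g ^ c * w) ^ p ^ E ∈ Q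
    rw [hadd, mul_pow, ← pow_mul]
    exact Q.add_mem (hJQ (hIJ i hi)) (Q.mul_mem_right _ (Q.pow_mem_of_pow_mem hgQ hec))
  obtain ⟨s, hs, hs'⟩ := Submodule.isLasker B B (J ⊔ Ideal.span {φ h})
  have hsQ : ∀ Q : Ideal B, Q ∈ s → Q.IsPrimary ∧ (Q.radical ^ c).frobeniusPower (p ^ E) ≤ Q := fun Q hQ =>
    ⟨hs' hQ, hlask Q (hs' hQ) (hs ▸ Finset.inf_le hQ)⟩
  by_cases htop : Q₀ = ⊤
  · exact ⟨s, by rw [hinf, htop, top_inf_eq, hs], hsQ⟩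
  · refine ⟨insert Q₀ s, by rw [Finset.inf_insert, hs]; exact hinf, fun Q hQ => ?_⟩
    rcases Finset.mem_insert.mp hQ with rfl | hQ
    · exact hprim₀ htop
    · exact hsQ Q hQ

/-! ### Graded pieces modulo the powers of the variables -/

section BoundedExponents

variable {A : Type*} [CommRing A] {n : ℕ} (q d : ℕ)

/-- The exponents of total degree `d` all of whose entries are smaller than `q`. -/
abbrev BoundedExponent (n q d : ℕ) : Type :=
  {a : Fin n →₀ ℕ // (∀ i, a i < q) ∧ a.degree = d}

/-- The fixed total degree determines the first entry from the others. This saves one factor `q` and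
produces the exponent `n - 1` of the theorem. -/
theorem BoundedExponent.exists_injective (m : ℕ) :
    ∃ g : BoundedExponent (m + 1) q d → Fin m → Fin q, Function.Injective g := by
  refine ⟨fun a i => ⟨a.1 i.succ, a.2.1 _⟩, fun a b hab => ?_⟩
  have h1 : ∀ i : Fin m, a.1 i.succ = b.1 i.succ := fun i => by
    simpa using congrFun hab i
  have h2 := a.2.2.trans b.2.2.symm
  rw [Finsupp.degree_eq_sum, Finsupp.degree_eq_sum, Fin.sum_univ_succ, Fin.sum_univ_succ,
    Finset.sum_congr rfl fun i _ => h1 i] at h2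
  ext i
  refine Fin.cases ?_ h1 i
  omega

instance BoundedExponent.finite : Finite (BoundedExponent n q d) := by
  cases n with
  | zero => infer_instance
  | succ m =>
    obtain ⟨g, hg⟩ := BoundedExponent.exists_injective q d m
    exact Finite.of_injective g hg

noncomputable instance BoundedExponent.fintype : Fintype (BoundedExponent n q d) :=
  Fintype.ofFinite _

theorem BoundedExponent.card_le (hn : 0 < n) :
    Fintype.card (BoundedExponent n q d) ≤ q ^ (n - 1) := by
  obtain ⟨m, rfl⟩ := Nat.exists_eq_succ_of_ne_zero hn.ne'
  obtain ⟨g, hg⟩ := BoundedExponent.exists_injective q d m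
  simpa using Fintype.card_le_of_injective g hg

/-- The coefficients of a polynomial at the exponents in `BoundedExponent n q d`. -/
noncomputable def boundedCoeff : MvPolynomial (Fin n) A →ₗ[A] (BoundedExponent n q d → A) :=
  LinearMap.pi fun a => lcoeff A a.1

/-- The polynomial with given coefficients at the exponents in `BoundedExponent n q d`. -/
noncomputable def boundedPoly : (BoundedExponent n q d → A) →ₗ[A] MvPolynomial (Fin n) A :=
  ∑ a, (monomial a.1).comp (LinearMap.proj a)

/-- The part of degree `d` of a polynomial, with exponents smaller than `q`. -/
noncomputable def boundedPart : MvPolynomial (Fin n) A →ₗ[A] MvPolynomial (Fin n) A :=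
  (boundedPoly q d).comp (boundedCoeff q d)

theorem boundedCoeff_apply (z : MvPolynomial (Fin n) A) (a : BoundedExponent n q d) :
    boundedCoeff q d z a = coeff a.1 z := rfl

theorem coeff_boundedPart (z : MvPolynomial (Fin n) A) (m : Fin n →₀ ℕ) :
    coeff m (boundedPart q d z) = if (∀ i, m i < q) ∧ m.degree = d then coeff m z else 0 := by
  classical
  have h : coeff m (boundedPart q d z) =
      ∑ a : BoundedExponent n q d, if a.1 = m then coeff a.1 z else 0 := by
    simp [boundedPart, boundedPoly, boundedCoeff_apply, coeff_sum, coeff_monomial]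
  rw [h]
  split_ifs with hm
  · rw [Finset.sum_eq_single (⟨m, hm⟩ : BoundedExponent n q d)]
    · simp
    · intro b _ hb
      rw [if_neg fun h => hb (Subtype.ext h)]
    · simp
  · refine Finset.sum_eq_zero fun a _ => if_neg ?_
    rintro rfl
    exact hm a.2

/-- The ideal generated by the `F j` and the `q`-th powers of the variables. -/
noncomputable def powerIdeal {r : ℕ} (F : Fin r → MvPolynomial (Fin n) A) :
    Ideal (MvPolynomial (Fin n) A) :=
  Ideal.span (Set.range F) ⊔ Ideal.span (Set.range fun i : Fin n => X i ^ q)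

variable {r : ℕ} (F : Fin r → MvPolynomial (Fin n) A)

theorem mem_powerIdeal_of_forall_coeff (z : MvPolynomial (Fin n) A)
    (hz : ∀ a, coeff a z ≠ 0 → ∃ i, q ≤ a i) : z ∈ powerIdeal q F := by
  rw [z.as_sum]
  refine Ideal.sum_mem _ fun a ha => ?_
  obtain ⟨i, hi⟩ := hz a (mem_support_iff.mp ha)
  have h1 : monomial a (coeff a z) = monomial (a - Finsupp.single i q) (coeff a z) * X i ^ q := by
    rw [X_pow_eq_monomial, monomial_mul, mul_one, tsub_add_cancel_of_le (by simpa using hi)]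
  rw [h1]
  exact Ideal.mul_mem_left _ _ (Ideal.mem_sup_right (Ideal.subset_span ⟨i, rfl⟩))

theorem mem_powerIdeal_of_forall_boundedPart (z : MvPolynomial (Fin n) A)
    (hz : ∀ d ∈ Finset.range (n * q + 1), boundedPart q d z ∈ powerIdeal q F) :
    z ∈ powerIdeal q F := by
  rw [← sub_add_cancel z (∑ d ∈ Finset.range (n * q + 1), boundedPart q d z)]
  refine Ideal.add_mem _ (mem_powerIdeal_of_forall_coeff _ _ _ fun a ha => ?_)
    (Ideal.sum_mem _ hz)
  by_contra! hlt
  apply ha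
  have hdeg : a.degree < n * q + 1 := by
    rw [Finsupp.degree_eq_sum]
    have h1 : ∑ i, a i ≤ Fintype.card (Fin n) * q :=
      Finset.sum_le_card_nsmul Finset.univ a q fun i _ => (hlt i).le
    rw [Fintype.card_fin] at h1
    omega
  rw [coeff_sub, coeff_sum, Finset.sum_eq_single a.degree]
  · rw [coeff_boundedPart, if_pos ⟨hlt, rfl⟩, sub_self]
  · intro b _ hb
    rw [coeff_boundedPart, if_neg fun h => hb h.2.symm]
  · intro h
    exact absurd (Finset.mem_range.mpr hdeg) h

/-- The coefficient vectors of the products of the `F j` with monomials. -/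
noncomputable def relationVector (x : Fin r × (Fin n →₀ ℕ)) : BoundedExponent n q d → A :=
  boundedCoeff q d (F x.1 * monomial x.2 1)

/-- Multiples of `X i ^ q` have no coefficients at bounded exponents, so only the multiples of the
`F j` contribute. -/
theorem boundedCoeff_mem_span_of_mem (z : MvPolynomial (Fin n) A) (hz : z ∈ powerIdeal q F) :
    boundedCoeff q d z ∈ Submodule.span A (Set.range (relationVector q d F)) := by
  classical
  obtain ⟨y, hy, x, hx, rfl⟩ := Submodule.mem_sup.mp hz
  rw [map_add]
  refine Submodule.add_mem _ ?_ ?_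
  · obtain ⟨c, rfl⟩ := Ideal.mem_span_range_iff_exists_fun.mp hy
    rw [map_sum]
    refine Submodule.sum_mem _ fun j _ => ?_
    rw [(c j).as_sum, Finset.sum_mul, map_sum]
    refine Submodule.sum_mem _ fun b _ => ?_
    have h1 : monomial b (coeff b (c j)) * F j = coeff b (c j) • (F j * monomial b 1) := by
      rw [mul_comm, ← mul_smul_comm, smul_monomial, smul_eq_mul, mul_one]
    rw [h1, map_smul]
    exact Submodule.smul_mem _ _ (Submodule.subset_span ⟨(j, b), rfl⟩)
  · obtain ⟨c, rfl⟩ := Ideal.mem_span_range_iff_exists_fun.mp hx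
    rw [map_sum]
    refine Submodule.sum_mem _ fun i _ => ?_
    have h1 : boundedCoeff q d (c i * X i ^ q) = 0 := by
      ext a
      rw [boundedCoeff_apply, X_pow_eq_monomial, coeff_mul_monomial', if_neg, Pi.zero_apply]
      rw [Finsupp.single_le_iff, not_le]
      exact a.2.1 i
    rw [h1]
    exact Submodule.zero_mem _

/-- A monomial multiple of `F j` lives in one degree. Its truncation is zero in any other degree
`d`; in its own degree it only drops monomials divisible by some `X i ^ q`. -/
theorem boundedPoly_mem_of_mem_span (hF : ∀ j, ∃ l, (F j).IsHomogeneous l)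
    (v : BoundedExponent n q d → A)
    (hv : v ∈ Submodule.span A (Set.range (relationVector q d F))) :
    boundedPoly q d v ∈ powerIdeal q F := by
  induction hv using Submodule.span_induction with
  | mem x hx =>
    obtain ⟨⟨j, b⟩, rfl⟩ := hx
    obtain ⟨l, hl⟩ := hF j
    have hP : (F j * monomial b 1).IsHomogeneous (l + b.degree) :=
      hl.mul (isHomogeneous_monomial _ rfl)
    change boundedPart q d (F j * monomial b 1) ∈ powerIdeal q F
    have hmem : F j * monomial b 1 ∈ powerIdeal q F :=
      Ideal.mul_mem_right _ _ (Ideal.mem_sup_left (Ideal.subset_span ⟨j, rfl⟩))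
    generalize F j * monomial b 1 = P at hP hmem
    have hPd : ∀ a, coeff a P ≠ 0 → a.degree = l + b.degree := fun a ha => by
      rw [← hP ha, Finsupp.degree_eq_weight_one]
      rfl
    by_cases hd : l + b.degree = d
    · rw [← sub_sub_cancel P (boundedPart q d P)]
      refine Ideal.sub_mem _ hmem (mem_powerIdeal_of_forall_coeff _ _ _ fun a ha => ?_)
      by_contra! hlt
      rw [coeff_sub, coeff_boundedPart] at ha
      split_ifs at ha with h1
      · simp at ha
      · rw [sub_zero] at ha
        exact h1 ⟨hlt, by rw [hPd a ha, hd]⟩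
    · have h0 : boundedPart q d P = 0 := by
        ext a
        rw [coeff_boundedPart, coeff_zero]
        split_ifs with h1
        · by_contra ha
          exact hd (by rw [← h1.2, hPd a ha])
        · rfl
      rw [h0]
      exact Ideal.zero_mem _
  | zero => rw [map_zero]; exact Ideal.zero_mem _
  | add x y _ _ hx hy => rw [map_add]; exact Ideal.add_mem _ hx hy
  | smul a x _ hx => rw [map_smul, smul_eq_C_mul]; exact Ideal.mul_mem_left _ _ hx

theorem boundedPart_mem_powerIdeal (hF : ∀ j, ∃ l, (F j).IsHomogeneous l)
    (z : MvPolynomial (Fin n) A) (hz : z ∈ powerIdeal q F) :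
    boundedPart q d z ∈ powerIdeal q F :=
  boundedPoly_mem_of_mem_span q d F hF _ (boundedCoeff_mem_span_of_mem q d F z hz)

theorem boundedPart_C_mul (a : A) (z : MvPolynomial (Fin n) A) :
    boundedPart q d (C a * z) = C a * boundedPart q d z := by
  rw [← smul_eq_C_mul, map_smul, smul_eq_C_mul]

end BoundedExponents

/-! ### Bounding the torsion over `k[t]` -/

theorem exists_C_mul_boundedPart_mem_powerIdeal {k : Type*} [Field k] {n r : ℕ} (q : ℕ)
    (F : Fin r → MvPolynomial (Fin n) (Polynomial k)) (hn : 0 < n)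
    (hF : ∀ j, ∃ l, (F j).IsHomogeneous l) (D : ℕ) (hD : ∀ j a, (coeff a (F j)).natDegree ≤ D)
    (d : ℕ) :
    ∃ h : Polynomial k, h ≠ 0 ∧ h.natDegree ≤ D * q ^ (n - 1) ∧
      ∀ s : Polynomial k, s ≠ 0 → ∀ z, C s * z ∈ powerIdeal q F →
        C h * boundedPart q d z ∈ powerIdeal q F := by
  classical
  obtain ⟨h, h0, hdeg, hh⟩ := Polynomial.exists_smul_mem_span_of_natDegree_le
    (relationVector q d F) D (by
      rintro ⟨j, b⟩ a
      rw [relationVector, boundedCoeff_apply, coeff_mul_monomial']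
      split_ifs
      · rw [mul_one]; exact hD _ _
      · simp)
  refine ⟨h, h0, hdeg.trans (Nat.mul_le_mul_left _ (BoundedExponent.card_le q d hn)),
    fun s hs z hz => ?_⟩
  have h1 := boundedCoeff_mem_span_of_mem q d F _ hz
  rw [← smul_eq_C_mul, map_smul] at h1
  have h2 := boundedPoly_mem_of_mem_span q d F hF _ (hh s hs _ h1)
  rwa [map_smul, smul_eq_C_mul] at h2

/-- The `k[t]`-torsion modulo `powerIdeal q F` is annihilated by a nonzero polynomial in which each
irreducible factor has multiplicity at most `D * q ^ (n - 1)`. -/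
theorem exists_torsion_annihilator_powerIdeal {k : Type*} [Field k] {n r : ℕ} (q : ℕ)
    (F : Fin r → MvPolynomial (Fin n) (Polynomial k)) (hn : 0 < n)
    (hF : ∀ j, ∃ l, (F j).IsHomogeneous l) (D : ℕ) (hD : ∀ j a, (coeff a (F j)).natDegree ≤ D) :
    ∃ h : Polynomial k, h ≠ 0 ∧
      (∀ s : Polynomial k, s ≠ 0 → ∀ z, C s * z ∈ powerIdeal q F → C h * z ∈ powerIdeal q F) ∧
      ∀ g : Polynomial k, Irreducible g → ∀ e : ℕ, g ^ e ∣ h → e ≤ D * q ^ (n - 1) := by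
  classical
  choose H H0 Hdeg HH using
    exists_C_mul_boundedPart_mem_powerIdeal q F hn hF D hD
  let 𝔞 : Ideal (Polynomial k) :=
    { carrier := {a | ∀ s : Polynomial k, s ≠ 0 → ∀ z, C s * z ∈ powerIdeal q F →
        C a * z ∈ powerIdeal q F}
      add_mem' := fun {a b} ha hb s hs z hz => by
        rw [C_add, add_mul]
        exact Ideal.add_mem _ (ha s hs z hz) (hb s hs z hz)
      zero_mem' := fun s hs z hz => by simp
      smul_mem' := fun a b hb s hs z hz => by
        rw [smul_eq_mul, C_mul, mul_assoc]
        exact Ideal.mul_mem_left _ _ (hb s hs z hz) }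
  -- The product only shows `𝔞 ≠ 0`: its multiplicities add up over all degrees, so the sharp bound
  -- has to come from the generator.
  have hprod : ∏ d ∈ Finset.range (n * q + 1), H d ∈ 𝔞 := by
    intro s hs z hz
    refine mem_powerIdeal_of_forall_boundedPart q F _ fun d hd => ?_
    rw [boundedPart_C_mul, ← Finset.prod_erase_mul _ _ hd, C_mul, mul_assoc]
    exact Ideal.mul_mem_left _ _ (HH d s hs z hz)
  obtain ⟨h, hgen⟩ := IsPrincipalIdealRing.principal 𝔞
  have hgen' : 𝔞 = Ideal.span {h} := hgen
  have hh : h ∈ 𝔞 := by rw [hgen']; exact Ideal.mem_span_singleton_self h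
  have h0 : h ≠ 0 := by
    rintro rfl
    rw [hgen', Ideal.mem_span_singleton, zero_dvd_iff, Finset.prod_eq_zero_iff] at hprod
    obtain ⟨d, -, hd⟩ := hprod
    exact H0 d hd
  refine ⟨h, h0, hh, fun g hg e hge => ?_⟩
  by_contra! hlt
  obtain ⟨u, hu⟩ := hge
  -- In each degree both `H d` and `g ^ e` kill the class of `u * z`, hence so does their gcd, a
  -- power of `g` with exponent at most `deg (H d)`. This would put a proper divisor of `h` in `𝔞`.
  have hmem : g ^ (D * q ^ (n - 1)) * u ∈ 𝔞 := by
    intro s hs z hz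
    refine mem_powerIdeal_of_forall_boundedPart q F _ fun d _ => ?_
    rw [C_mul, mul_assoc, boundedPart_C_mul]
    have hy : C (g ^ e) * (C u * z) ∈ powerIdeal q F := by
      rw [← mul_assoc, ← C_mul, ← hu]
      exact hh s hs z hz
    generalize C u * z = y at hy
    have h1 := HH d _ (pow_ne_zero e hg.ne_zero) y hy
    have h2 := boundedPart_mem_powerIdeal q d F hF _ hy
    rw [boundedPart_C_mul] at h2
    obtain ⟨u', hu', hgu'⟩ :=
      (FiniteMultiplicity.of_prime_left hg.prime (H0 d)).exists_eq_pow_mul_and_not_dvd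
    generalize multiplicity g (H d) = e' at hu'
    have he' : e' ≤ D * q ^ (n - 1) := by
      refine le_trans ?_ (Hdeg d)
      have h3 := Polynomial.natDegree_le_of_dvd (Dvd.intro _ hu'.symm) (H0 d)
      rw [Polynomial.natDegree_pow] at h3
      exact (Nat.le_mul_of_pos_right _ hg.natDegree_pos).trans h3
    obtain ⟨a, b, hab⟩ : IsCoprime u' (g ^ (e - e')) :=
      (((Irreducible.coprime_iff_not_dvd hg).mpr hgu').pow_left).symm
    have h4 : g ^ (D * q ^ (n - 1)) = g ^ (D * q ^ (n - 1) - e') * (a * H d + b * g ^ e) := by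
      have h5 : g ^ e = g ^ e' * g ^ (e - e') := by rw [← pow_add]; congr 1; omega
      have h6 : g ^ (D * q ^ (n - 1)) = g ^ (D * q ^ (n - 1) - e') * g ^ e' := by
        rw [← pow_add]; congr 1; omega
      rw [h6, hu', h5]
      linear_combination (-(g ^ (D * q ^ (n - 1) - e') * g ^ e')) * hab
    rw [h4, C_mul, mul_assoc]
    refine Ideal.mul_mem_left _ _ ?_
    rw [C_add, add_mul, C_mul, C_mul, mul_assoc, mul_assoc]
    exact Ideal.add_mem _ (Ideal.mul_mem_left _ _ h1) (Ideal.mul_mem_left _ _ h2)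
  rw [hgen', Ideal.mem_span_singleton, hu] at hmem
  have hu0 : u ≠ 0 := by
    rintro rfl
    exact h0 (by rw [hu, mul_zero])
  have := (pow_dvd_pow_iff hg.ne_zero hg.not_isUnit).mp ((mul_dvd_mul_iff_right hu0).mp hmem)
  omega

/-! ### Application to `R` -/

theorem MvPolynomial.isHomogeneous_optionEquivRight {k : Type*} [Field k] {n d : ℕ}
    {f : MvPolynomial (Option (Fin n)) k} (hf : IsWeightedHomogeneous (txWeight n) f d) :
    (optionEquivRight k (Fin n) f).IsHomogeneous d := by
  rw [f.as_sum, map_sum]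
  refine IsHomogeneous.sum _ _ _ fun m hm => ?_
  rw [optionEquivRight_apply, aeval_monomial]
  rw [← zero_add d, ← hf (mem_support_iff.mp hm), Finsupp.weight_apply]
  refine IsHomogeneous.mul (isHomogeneous_C _ _) (IsHomogeneous.prod _ _ _ fun o _ => ?_)
  rcases o with _ | i
  · simpa [txWeight] using (isHomogeneous_C (Fin n) (Polynomial.X : Polynomial k)).pow (m none)
  · simpa [txWeight] using (isHomogeneous_X (Polynomial k) i).pow (m (some i))

theorem mainTheorem2 {k : Type*} [Field k] (p : ℕ) [Fact p.Prime] [CharP k p]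
    (n : ℕ) (hn : 2 ≤ n) (r : ℕ) (f : Fin r → MvPolynomial (Option (Fin n)) k)
    (hf : ∀ j : Fin r, ∃ d : ℕ, IsWeightedHomogeneous (txWeight n) (f j) d) :
    ∃ c : ℕ, ∀ e q : ℕ, q = p ^ e →
      ∃ (m : ℕ) (Q : Fin m → Ideal (TXQuotient f)),
        (xIdeal f).frobeniusPower q = ⨅ i : Fin m, Q i ∧
        (∀ i : Fin m, (Q i).IsPrimary) ∧
        ∀ i : Fin m, ((Q i).radical ^ c).frobeniusPower (q ^ (n - 1)) ≤ Q i := by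
  classical
  have hp : p.Prime := Fact.out
  let ε := optionEquivRight k (Fin n)
  let F : Fin r → MvPolynomial (Fin n) (Polynomial k) := fun j => ε (f j)
  have hF : ∀ j, ∃ l, (F j).IsHomogeneous l := fun j =>
    (hf j).imp fun _ h => isHomogeneous_optionEquivRight h
  let D := Finset.univ.sup fun j => (F j).support.sup fun a => (coeff a (F j)).natDegree
  have hD : ∀ j a, (coeff a (F j)).natDegree ≤ D := by
    intro j a
    by_cases ha : coeff a (F j) = 0
    · simp [ha]
    · exact (Finset.le_sup (f := fun a => (coeff a (F j)).natDegree)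
        (mem_support_iff.mpr ha)).trans (Finset.le_sup
          (f := fun j => (F j).support.sup fun a => (coeff a (F j)).natDegree)
          (Finset.mem_univ j))
  let mk := Ideal.Quotient.mk (Ideal.span (Set.range f))
  let ψ : MvPolynomial (Fin n) (Polynomial k) →+* TXQuotient f :=
    mk.comp (ε.symm : MvPolynomial (Fin n) (Polynomial k) →+* MvPolynomial (Option (Fin n)) k)
  have hψ : ∀ y, ψ y = mk (ε.symm y) := fun _ => rfl
  have hψ_surj : Function.Surjective ψ :=
    Ideal.Quotient.mk_surjective.comp ε.symm.surjective
  have hψX : ∀ i, ψ (X i) = mk (X (some i)) := fun i => by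
    rw [hψ, ← optionEquivRight_X_some, AlgEquiv.symm_apply_apply]
  have hB : (p : TXQuotient f) = 0 := by
    have h1 : (p : MvPolynomial (Option (Fin n)) k) = 0 := CharP.cast_eq_zero _ p
    rw [← map_natCast mk, h1, map_zero]
  have hX : ∀ i, ψ (X i) ∈ xIdeal f := fun i => by
    rw [hψX]; exact Ideal.subset_span ⟨i, rfl⟩
  have hsurj : ∀ b : TXQuotient f, ∃ a, b - ψ.comp C a ∈ xIdeal f := by
    intro b
    obtain ⟨z, rfl⟩ := hψ_surj b
    induction z using MvPolynomial.induction_on with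
    | C a => exact ⟨a, by simp⟩
    | add z w hz hw =>
      obtain ⟨a, ha⟩ := hz
      obtain ⟨b, hb⟩ := hw
      refine ⟨a + b, ?_⟩
      rw [map_add, map_add, add_sub_add_comm]
      exact Ideal.add_mem _ ha hb
    | mul_X z i _ =>
      refine ⟨0, ?_⟩
      rw [map_zero, sub_zero, map_mul]
      exact Ideal.mul_mem_left _ _ (hX i)
  -- `D` may be 0, while the component with radical `I` needs a positive exponent.
  refine ⟨D + 1, ?_⟩
  rintro e q rfl
  have hfrob : (xIdeal f).frobeniusPower (p ^ e) =
      Ideal.span (Set.range fun i => ψ (X i ^ p ^ e)) := by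
    rw [xIdeal, Ideal.frobeniusPower_span hp hB, ← Set.range_comp]
    congr 2
    ext i
    rw [map_pow, hψX]
    rfl
  have hmem : ∀ y, ψ y ∈ (xIdeal f).frobeniusPower (p ^ e) ↔ y ∈ powerIdeal (p ^ e) F := by
    intro y
    rw [hfrob]
    constructor
    · intro hy
      obtain ⟨c, hc⟩ := Ideal.mem_span_range_iff_exists_fun.mp hy
      choose c' hc' using fun i => hψ_surj (c i)
      have h1 : ψ (y - ∑ i, c' i * X i ^ p ^ e) = 0 := by
        rw [map_sub, map_sum, sub_eq_zero, ← hc]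
        exact Finset.sum_congr rfl fun i _ => by rw [map_mul, hc']
      rw [hψ, Ideal.Quotient.eq_zero_iff_mem] at h1
      obtain ⟨b, hb⟩ := Ideal.mem_span_range_iff_exists_fun.mp h1
      have h2 : y - ∑ i, c' i * X i ^ p ^ e = ∑ j, ε (b j) * F j := by
        rw [← ε.apply_symm_apply (y - _), ← hb, map_sum]
        exact Finset.sum_congr rfl fun j _ => map_mul _ _ _
      rw [← sub_add_cancel y (∑ i, c' i * X i ^ p ^ e), h2]
      exact Submodule.add_mem_sup
        (Ideal.sum_mem _ fun j _ => Ideal.mul_mem_left _ _ (Ideal.subset_span ⟨j, rfl⟩))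
        (Ideal.sum_mem _ fun i _ => Ideal.mul_mem_left _ _ (Ideal.subset_span ⟨i, rfl⟩))
    · intro hy
      suffices H : powerIdeal (p ^ e) F ≤
          Ideal.comap ψ (Ideal.span (Set.range fun i => ψ (X i ^ p ^ e))) from H hy
      refine sup_le ?_ ?_
      · refine Ideal.span_le.mpr ?_
        rintro _ ⟨j, rfl⟩
        have h1 : ψ (F j) = 0 := by
          rw [hψ, AlgEquiv.symm_apply_apply]
          exact Ideal.Quotient.eq_zero_iff_mem.mpr (Ideal.subset_span ⟨j, rfl⟩)
        rw [SetLike.mem_coe, Ideal.mem_comap, h1]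
        exact Ideal.zero_mem _
      · refine Ideal.span_le.mpr ?_
        rintro _ ⟨i, rfl⟩
        exact Ideal.subset_span ⟨i, rfl⟩
  obtain ⟨h, h0, hh, hmul⟩ :=
    exists_torsion_annihilator_powerIdeal (p ^ e) F (by omega) hF D hD
  rw [← pow_mul] at hmul ⊢
  refine exists_primary_decomposition_of_torsion_annihilator hp hB (ψ.comp C) (xIdeal f) _ hsurj
    (e * (n - 1)) (D + 1) D.succ_pos (fun i hi => ?_) h h0 (fun b s hs hb => ?_)
    fun g hg l hl => (hmul g hg l hl).trans (Nat.mul_le_mul_right _ D.le_succ)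
  -- Here `2 ≤ n` enters: it gives `q ≤ q^(n-1)`.
  · exact Ideal.pow_mem_of_pow_mem _ (Ideal.pow_mem_frobeniusPower hi (p ^ e))
      (Nat.pow_le_pow_right hp.pos (Nat.le_mul_of_pos_right e (by omega)))
  · obtain ⟨z, rfl⟩ := hψ_surj b
    rw [RingHom.comp_apply, ← map_mul, hmem] at hb ⊢
    exact hh s hs z hb
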